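/- Let $\lambda>0$, $H\in(0,1)$ and $s\ge 0$. The function $x\mapsto e^{isx}\,|x|^{1-2H}/(\lambda^2+x^2)$ is Lebesgue integrable on $\mathbb{R}$, and $$\widehat f_{H,\lambda}(s):=\int_{-\infty}^{\infty}e^{isx}\,\frac{|x|^{1-2H}}{\lambda^2+x^2}\,dx=\frac{\pi}{\sin(\pi H)}\left\{\lambda^{-2H}\cosh(\lambda s)-\frac{s^{2H}}{\Gamma(2H+1)}\;{}_1F_2\!\left(1;H+\tfrac12,H+1;\tfrac{\lambda^2s^2}{4}\right)\right\},$$ where ${}_1F_2$ is the generalised hypergeometric function $${}_1F_2(a;b_1,b_2;z):=\sum_{n=0}^{\infty}\frac{(a)_n}{(b_1)_n(b_2)_n}\,\frac{z^n}{n!},\qquad (a)_n:=\frac{\Gamma(a+n)}{\Gamma(a)}=a(a+1)\cdots(a+n-1),$$ whose series converges absolutely at the parameters above. In particular, for $H=1/2$, every $\lambda>0$ and every $s\ge 0$, $$\widehat f_{1/2,\lambda}(s)=\frac{\pi}{\lambda}\,e^{-\lambda s}.$$ -/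

import Mathlib

open MeasureTheory

/-- The `n`-th term `(a)_n / ((b₁)_n (b₂)_n) * z ^ n / n!` of the series `₁F₂(a; b₁, b₂; z)`, where
`(a)_n` is the rising factorial `a (a + 1) ⋯ (a + n - 1)`, Mathlib's `ascPochhammer`
(equal to `Γ(a + n) / Γ(a)`, see `ascPochhammer_eval_eq_Gamma_div_Gamma`). -/
noncomputable def hyp1F2Term (a b₁ b₂ z : ℂ) (n : ℕ) : ℂ :=
  (ascPochhammer ℂ n).eval a / ((ascPochhammer ℂ n).eval b₁ * (ascPochhammer ℂ n).eval b₂) *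
    (z ^ n / (n.factorial : ℂ))

/-- The generalised hypergeometric function `₁F₂(a; b₁, b₂; z)`. -/
noncomputable def hyp1F2 (a b₁ b₂ z : ℂ) : ℂ :=
  ∑' n : ℕ, hyp1F2Term a b₁ b₂ z n

/-- The rising factorial is the quotient `Γ(a + n) / Γ(a)` whenever `a` is not a pole of `Γ`. -/
theorem ascPochhammer_eval_eq_Gamma_div_Gamma (a : ℂ) (ha : ∀ m : ℕ, a ≠ -m) (n : ℕ) :
    (ascPochhammer ℂ n).eval a = Complex.Gamma (a + n) / Complex.Gamma a := by
  induction n with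
  | zero => simp [Complex.Gamma_ne_zero ha]
  | succ n ih =>
    have h : a + n ≠ 0 := fun h => ha n (eq_neg_of_add_eq_zero_left h)
    rw [ascPochhammer_succ_eval, ih, Nat.cast_succ, ← add_assoc, Complex.Gamma_add_one _ h]
    ring

/-- The function `x ↦ e^{isx} |x|^{1 - 2H} / (lam² + x²)` on the real line. -/
noncomputable def fouIntegrand (H lam s : ℝ) (x : ℝ) : ℂ :=
  Complex.exp (Complex.I * (s : ℂ) * (x : ℂ)) *
    ((|x| ^ (1 - 2 * H) / (lam ^ 2 + x ^ 2) : ℝ) : ℂ)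

/-- The Fourier transform `∫_ℝ e^{isx} |x|^{1 - 2H} / (lam² + x²) dx`. -/
noncomputable def fouHat (H lam s : ℝ) : ℂ :=
  ∫ x : ℝ, fouIntegrand H lam s x

/-!
Put `w x = x ^ (1 - 2H) / (lam² + x²)` and `φ s = ∫₀^∞ cos (s x) w x dx`. By parity `fouHat = 2 φ`.
The formula comes from an integral equation for `φ`, with no contour integration.

Since `x ^ (-1 - 2H) = w x + lam² w x / x²` and `(1 - cos (s x)) / x² = ∫₀^s (s - t) cos (t x) dt`,
integrating `(1 - cos (s x)) x ^ (-1 - 2H)` over the half-line and using Fubini gives the Volterra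
equation (`integral_cos_mul_volterra`)
`φ s = A - B s ^ (2H) + lam² ∫₀^s (s - t) φ t dt`,
where `A = ∫₀^∞ w` and `B s ^ (2H) = ∫₀^∞ (1 - cos (s x)) x ^ (-1 - 2H) dx`.

Both constants are evaluated by Tonelli's theorem. Writing `1 / (lam² + x²)` as a Laplace integral
turns `A` into `Γ(H) Γ(1 - H) lam ^ (-2H) / 2` (`integral_Ioi_rpow_div_sq_add_sq`), and writing
`Γ(2H + 1) x ^ (-1 - 2H)` as one turns `B s ^ (2H)` into `s² / Γ(2H + 1)` times an integral of
the first kind, with `1 - H` for `H` and `s` for `lam`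
(`integral_Ioi_one_sub_cos_mul_rpow`). The reflection formula then brings in `π / sin (π H)`.

As `φ` is continuous and bounded, Picard iteration of the Volterra equation converges to `φ`: the
remainder after `N` steps is at most a constant times `(lam s) ^ (2N) / (2N)!`
(`hasSum_volterraTerm_of_integral_eq`). The iterates of `A` sum to `A cosh (lam s)`, and those of
`B s ^ (2H)` have terms `B lam ^ (2n) s ^ (2H + 2n) / (2H + 1)_{2n}`, that is `B s ^ (2H)` times
the terms of `₁F₂`, by the duplication `(2H + 1)_{2n} = 4 ^ n (H + 1/2)_n (H + 1)_n`.
For `H = 1/2` the second series is that of `sinh`.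
-/

open Set Filter Topology
open scoped Nat

/-! ### Evaluation of the two half-line integrals -/

/-- Tonelli's theorem on the quadrant `x, y > 0` for Bochner integrals: it suffices that `F` is
integrable in `x` for each fixed `y` and that the resulting marginal `b` is integrable; integrability
of the other marginal `a` is part of the conclusion. -/
theorem integrableOn_and_integral_eq_of_nonneg_swap {F : ℝ → ℝ → ℝ} {a b : ℝ → ℝ}
    (hm : Measurable (Function.uncurry F)) (h0 : ∀ x > 0, ∀ y > 0, 0 ≤ F x y)
    (hrow : ∀ x > 0, ∫ y in Ioi 0, F x y = a x)
    (hcol : ∀ y > 0, IntegrableOn (fun x => F x y) (Ioi 0) ∧ ∫ x in Ioi 0, F x y = b y)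
    (hb : IntegrableOn b (Ioi 0)) :
    IntegrableOn a (Ioi 0) ∧ ∫ x in Ioi 0, a x = ∫ y in Ioi 0, b y := by
  have hint : Integrable (Function.uncurry F)
      ((volume.restrict (Ioi 0)).prod (volume.restrict (Ioi 0))) := by
    rw [integrable_prod_iff' hm.aestronglyMeasurable]
    refine ⟨(ae_restrict_mem measurableSet_Ioi).mono fun y hy => (hcol y hy).1, ?_⟩
    refine IntegrableOn.congr_fun hb (fun y hy => ?_) measurableSet_Ioi
    rw [← (hcol y hy).2]
    refine setIntegral_congr_fun measurableSet_Ioi fun x hx => ?_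
    simp only [Function.uncurry_apply_pair]
    rw [Real.norm_of_nonneg (h0 x hx y hy)]
  constructor
  · exact IntegrableOn.congr_fun hint.integral_prod_left (fun x hx => hrow x hx) measurableSet_Ioi
  · rw [← setIntegral_congr_fun measurableSet_Ioi (fun x hx => hrow x hx),
      integral_integral_swap hint]
    exact setIntegral_congr_fun measurableSet_Ioi fun y hy => (hcol y hy).2

/-- The integral of the weight `x ^ (1 - 2H) / (lam² + x²)`, obtained from
`1 / (lam² + x²) = ∫₀^∞ exp (-(lam² + x²) t) dt` and the reflection formula for `Γ`. -/
theorem integral_Ioi_rpow_div_sq_add_sq {H lam : ℝ} (hl : 0 < lam) (h0 : 0 < H) (h1 : H < 1) :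
    IntegrableOn (fun x => x ^ (1 - 2 * H) / (lam ^ 2 + x ^ 2)) (Ioi 0) ∧
    ∫ x in Ioi 0, x ^ (1 - 2 * H) / (lam ^ 2 + x ^ 2) =
      Real.pi / Real.sin (Real.pi * H) / 2 * lam ^ (-2 * H) := by
  have key := integrableOn_and_integral_eq_of_nonneg_swap
    (F := fun x t => x ^ (1 - 2 * H) * Real.exp (-((lam ^ 2 + x ^ 2) * t)))
    (a := fun x => x ^ (1 - 2 * H) / (lam ^ 2 + x ^ 2))
    (b := fun t => Real.Gamma (1 - H) / 2 * (t ^ (H - 1) * Real.exp (-(lam ^ 2 * t))))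
    ?_ ?_ ?_ ?_ ?_
  · refine ⟨key.1, key.2.trans ?_⟩
    rw [integral_const_mul, Real.integral_rpow_mul_exp_neg_mul_Ioi h0 (by positivity),
      ← Real.Gamma_mul_Gamma_one_sub]
    have : (1 / lam ^ 2) ^ H = lam ^ (-2 * H) := by
      rw [one_div, ← Real.rpow_natCast, ← Real.rpow_neg hl.le, ← Real.rpow_mul hl.le]
      norm_num
    rw [this]; ring
  · fun_prop
  · intro x hx y hy
    have : (0:ℝ) < x := hx
    positivity
  · intro x hx
    have hx' : (0:ℝ) < lam ^ 2 + x ^ 2 := by positivity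
    have := Real.integral_rpow_mul_exp_neg_mul_Ioi (a := 1) one_pos hx'
    simp only [sub_self, Real.rpow_zero, one_mul, Real.rpow_one, Real.Gamma_one, mul_one] at this
    rw [integral_const_mul, this]; ring
  · intro t ht
    have hq : (-1:ℝ) < 1 - 2 * H := by linarith
    have e : (fun x : ℝ => x ^ (1 - 2 * H) * Real.exp (-((lam ^ 2 + x ^ 2) * t))) =
        fun x => Real.exp (-(lam ^ 2 * t)) * (x ^ (1 - 2 * H) * Real.exp (-t * x ^ (2:ℝ))) := by
      funext x
      rw [mul_left_comm, ← Real.exp_add, Real.rpow_two]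
      ring_nf
    simp only [e]
    refine ⟨(integrableOn_rpow_mul_exp_neg_mul_rpow hq two_pos ht).const_mul _, ?_⟩
    rw [integral_const_mul, integral_rpow_mul_exp_neg_mul_rpow two_pos hq ht,
      show -(1 - 2 * H + 1) / 2 = H - 1 by ring, show (1 - 2 * H + 1) / 2 = 1 - H by ring]
    ring
  · have := (integrableOn_rpow_mul_exp_neg_mul_rpow (s := H - 1) (by linarith) one_pos
      (pow_pos hl 2)).const_mul (Real.Gamma (1 - H) / 2)
    simpa only [IntegrableOn, Real.rpow_one, neg_mul] using this

theorem integral_Ioi_one_sub_cos_mul_exp_neg (s : ℝ) {t : ℝ} (ht : 0 < t) :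
    IntegrableOn (fun x => (1 - Real.cos (s * x)) * Real.exp (-(t * x))) (Ioi 0) ∧
    ∫ x in Ioi 0, (1 - Real.cos (s * x)) * Real.exp (-(t * x)) = s ^ 2 / (t * (s ^ 2 + t ^ 2)) := by
  have hre : (-(t : ℂ) + s * Complex.I).re < 0 := by simpa
  -- The integrand is the real part of a difference of two exponentials.
  have e : (fun x : ℝ => (1 - Real.cos (s * x)) * Real.exp (-(t * x))) = fun x : ℝ =>
      Real.exp (-t * x) - RCLike.re (Complex.exp ((-(t : ℂ) + s * Complex.I) * x)) := by
    funext x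
    simp [Complex.exp_re]
    ring
  have i1 := integrableOn_exp_mul_Ioi (a := -t) (by linarith) 0
  have i2 := integrableOn_exp_mul_complex_Ioi hre 0
  rw [e]
  refine ⟨i1.sub i2.re, ?_⟩
  rw [integral_sub i1 i2.re, integral_exp_mul_Ioi (by linarith), integral_re i2,
    integral_exp_mul_complex_Ioi hre]
  have : t ^ 2 + s ^ 2 ≠ 0 := by positivity
  have : s ^ 2 + t ^ 2 ≠ 0 := by positivity
  simp [Complex.div_re, Complex.normSq_apply]
  field_simp
  ring

/-- The integral of `(1 - cos (s x)) x ^ (-1 - 2H)`, obtained from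
`Γ(2H + 1) x ^ (-1 - 2H) = ∫₀^∞ t ^ (2H) exp (-x t) dt`. The inner integral is then
`s² / (t (s² + t²))`, so that the weight of `integral_Ioi_rpow_div_sq_add_sq` reappears with
parameters `1 - H` and `s`. -/
theorem integral_Ioi_one_sub_cos_mul_rpow {H s : ℝ} (hs : 0 ≤ s) (h0 : 0 < H) (h1 : H < 1) :
    IntegrableOn (fun x => (1 - Real.cos (s * x)) * x ^ (-1 - 2 * H)) (Ioi 0) ∧
    ∫ x in Ioi 0, (1 - Real.cos (s * x)) * x ^ (-1 - 2 * H) =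
      Real.pi / Real.sin (Real.pi * H) / 2 * (s ^ (2 * H) / Real.Gamma (2 * H + 1)) := by
  -- At `s = 0` both sides vanish, since `0 ^ (2 * H) = 0` for `H > 0`.
  rcases hs.eq_or_lt with rfl | hs
  · simp [Real.zero_rpow (mul_pos two_pos h0).ne']
  have hG : 0 < Real.Gamma (2 * H + 1) := Real.Gamma_pos_of_pos (by linarith)
  obtain ⟨hwi, hw⟩ := integral_Ioi_rpow_div_sq_add_sq (H := 1 - H) hs (by linarith) (by linarith)
  have key := integrableOn_and_integral_eq_of_nonneg_swap
    (F := fun x t => (1 - Real.cos (s * x)) * (t ^ (2 * H) * Real.exp (-(x * t))))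
    (a := fun x => (1 - Real.cos (s * x)) * x ^ (-1 - 2 * H) * Real.Gamma (2 * H + 1))
    (b := fun t => s ^ 2 * (t ^ (1 - 2 * (1 - H)) / (s ^ 2 + t ^ 2)))
    ?_ ?_ ?_ ?_ ?_
  · have hi := key.1.mul_const (Real.Gamma (2 * H + 1))⁻¹
    have hv := key.2
    simp only [mul_inv_cancel_right₀ hG.ne'] at hi
    refine ⟨hi, ?_⟩
    rw [integral_mul_const, integral_const_mul, hw] at hv
    rw [eq_div_of_mul_eq hG.ne' hv, show Real.pi * (1 - H) = Real.pi - Real.pi * H by ring,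
      Real.sin_pi_sub]
    have : s ^ 2 * s ^ (-2 * (1 - H)) = s ^ (2 * H) := by
      rw [← Real.rpow_two, ← Real.rpow_add hs]; ring_nf
    rw [← this]; ring
  · fun_prop
  · intro x hx y hy
    have : (0:ℝ) < y := hy
    have := sub_nonneg.2 (Real.cos_le_one (s * x))
    positivity
  · intro x hx
    have := Real.integral_rpow_mul_exp_neg_mul_Ioi (a := 2 * H + 1) (by linarith) hx
    rw [add_sub_cancel_right] at this
    rw [integral_const_mul, this, one_div, Real.inv_rpow (le_of_lt hx),
      ← Real.rpow_neg (le_of_lt hx), mul_assoc]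
    ring_nf
  · intro t ht
    obtain ⟨i, v⟩ := integral_Ioi_one_sub_cos_mul_exp_neg s ht
    have e : (fun x : ℝ => (1 - Real.cos (s * x)) * (t ^ (2 * H) * Real.exp (-(x * t)))) =
        fun x => t ^ (2 * H) * ((1 - Real.cos (s * x)) * Real.exp (-(t * x))) := by
      funext x; ring_nf
    simp only [e]
    refine ⟨i.const_mul _, ?_⟩
    rw [integral_const_mul, v, show 1 - 2 * (1 - H) = 2 * H - 1 by ring, Real.rpow_sub_one ht.ne']
    have ht' : 0 < t := ht
    field_simp
  · exact hwi.const_mul _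

/-! ### The Volterra equation for the cosine transform -/

theorem continuous_integral_cos_mul {g : ℝ → ℝ} (hg : IntegrableOn g (Ioi 0)) :
    Continuous fun s => ∫ x in Ioi 0, Real.cos (s * x) * g x := by
  refine continuous_of_dominated (bound := fun x => ‖g x‖) (fun s => ?_) (fun s => ?_) hg.norm ?_
  · exact (by fun_prop : Continuous fun x => Real.cos (s * x)).aestronglyMeasurable.mul hg.1
  · refine Eventually.of_forall fun x => ?_
    rw [norm_mul]
    exact mul_le_of_le_one_left (norm_nonneg _) (Real.abs_cos_le_one _)
  · exact Eventually.of_forall fun x => by fun_prop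

theorem integrableOn_cos_mul {g : ℝ → ℝ} (hg : IntegrableOn g (Ioi 0)) (s : ℝ) :
    IntegrableOn (fun x => Real.cos (s * x) * g x) (Ioi 0) := by
  refine Integrable.bdd_mul (c := 1) hg
    (by fun_prop : Continuous fun x => Real.cos (s * x)).aestronglyMeasurable ?_
  refine ae_of_all _ fun x => ?_
  rw [Real.norm_eq_abs]
  exact Real.abs_cos_le_one _

theorem abs_integral_cos_mul_le {g : ℝ → ℝ} (hg : IntegrableOn g (Ioi 0)) (s : ℝ) :
    |∫ x in Ioi 0, Real.cos (s * x) * g x| ≤ ∫ x in Ioi 0, ‖g x‖ := by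
  rw [← Real.norm_eq_abs]
  refine norm_integral_le_of_norm_le hg.norm (Eventually.of_forall fun x => ?_)
  rw [norm_mul]
  exact mul_le_of_le_one_left (norm_nonneg _) (Real.abs_cos_le_one _)

theorem integral_sub_mul_cos (s : ℝ) {x : ℝ} (hx : x ≠ 0) :
    ∫ t in (0)..s, (s - t) * Real.cos (t * x) = (1 - Real.cos (s * x)) / x ^ 2 := by
  have := intervalIntegral.integral_eq_sub_of_hasDerivAt (a := 0) (b := s)
    -- the primitive found by integrating by parts
    (f := fun t => (s - t) * Real.sin (t * x) / x - Real.cos (t * x) / x ^ 2)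
    (f' := fun t => (s - t) * Real.cos (t * x)) (fun t _ => ?_)
    (Continuous.intervalIntegrable (by fun_prop) _ _)
  · rw [this]
    simp
    ring
  · have h1 : HasDerivAt (fun t => t * x) x t := by simpa using (hasDerivAt_id t).mul_const x
    have h2 : HasDerivAt (fun t => s - t) (-1) t := by simpa using (hasDerivAt_id t).const_sub s
    refine (((h2.mul h1.sin).div_const x).sub (h1.cos.div_const (x ^ 2))).congr_deriv ?_
    field_simp
    ring

theorem integral_sub_mul_integral_cos_mul {g : ℝ → ℝ} (hg : IntegrableOn g (Ioi 0)) {s : ℝ}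
    (hs : 0 ≤ s) :
    ∫ t in (0)..s, (s - t) * ∫ x in Ioi 0, Real.cos (t * x) * g x =
      ∫ x in Ioi 0, (1 - Real.cos (s * x)) / x ^ 2 * g x := by
  have hint : Integrable (Function.uncurry fun t x => (s - t) * Real.cos (t * x) * g x)
      ((volume.restrict (uIoc 0 s)).prod (volume.restrict (Ioi 0))) := by
    have hd : Integrable (fun z : ℝ × ℝ => s * ‖g z.2‖)
        ((volume.restrict (uIoc 0 s)).prod (volume.restrict (Ioi 0))) := by
      have : IsFiniteMeasure (volume.restrict (uIoc 0 s)) := by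
        rw [uIoc_of_le hs]; infer_instance
      exact (hg.norm.comp_snd _).const_mul s
    refine hd.mono' ?_ ?_
    · exact (by fun_prop : Continuous fun z : ℝ × ℝ =>
        (s - z.1) * Real.cos (z.1 * z.2)).aestronglyMeasurable.mul hg.1.comp_snd
    · rw [Measure.prod_restrict]
      refine (ae_restrict_mem (measurableSet_uIoc.prod measurableSet_Ioi)).mono ?_
      rintro ⟨t, x⟩ ⟨ht, -⟩
      simp only [uIoc_of_le hs, mem_Ioc] at ht
      simp only [Function.uncurry_apply_pair]
      rw [norm_mul, norm_mul]
      gcongr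
      refine (mul_le_of_le_one_right (norm_nonneg _) (Real.abs_cos_le_one _)).trans ?_
      rw [Real.norm_of_nonneg (by linarith)]
      linarith
  have := intervalIntegral_integral_swap hint
  simp only [mul_assoc, integral_const_mul] at this
  rw [this]
  refine setIntegral_congr_fun measurableSet_Ioi fun x hx => ?_
  simp only [← mul_assoc, intervalIntegral.integral_mul_const]
  rw [integral_sub_mul_cos s (ne_of_gt hx)]

/-- The cosine transform of `x ^ (1 - 2H) / (lam² + x²)` solves a Volterra equation of the second
kind, the integrated form of `φ'' = lam² φ - c s ^ (2H - 2)`. -/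
theorem integral_cos_mul_volterra {H lam s : ℝ} (hl : 0 < lam) (h0 : 0 < H) (h1 : H < 1)
    (hs : 0 ≤ s) :
    ∫ x in Ioi 0, Real.cos (s * x) * (x ^ (1 - 2 * H) / (lam ^ 2 + x ^ 2)) =
      Real.pi / Real.sin (Real.pi * H) / 2 * lam ^ (-2 * H) -
        Real.pi / Real.sin (Real.pi * H) / 2 / Real.Gamma (2 * H + 1) * s ^ (2 * H) +
        lam ^ 2 * ∫ t in (0)..s, (s - t) *
          ∫ x in Ioi 0, Real.cos (t * x) * (x ^ (1 - 2 * H) / (lam ^ 2 + x ^ 2)) := by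
  obtain ⟨hwi, hw⟩ := integral_Ioi_rpow_div_sq_add_sq hl h0 h1
  obtain ⟨hci, hc⟩ := integral_Ioi_one_sub_cos_mul_rpow hs h0 h1
  have hcw := integrableOn_cos_mul hwi s
  rw [integral_sub_mul_integral_cos_mul hwi hs, ← integral_const_mul]
  -- `lam² w / x² = x ^ (-1 - 2H) - w` for `w = x ^ (1 - 2H) / (lam² + x²)`
  have e : ∫ x in Ioi 0, lam ^ 2 * ((1 - Real.cos (s * x)) / x ^ 2 *
        (x ^ (1 - 2 * H) / (lam ^ 2 + x ^ 2))) =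
      ∫ x in Ioi 0, ((1 - Real.cos (s * x)) * x ^ (-1 - 2 * H) -
        (x ^ (1 - 2 * H) / (lam ^ 2 + x ^ 2) -
          Real.cos (s * x) * (x ^ (1 - 2 * H) / (lam ^ 2 + x ^ 2)))) := by
    refine setIntegral_congr_fun measurableSet_Ioi fun x hx => ?_
    have hx : (0:ℝ) < x := hx
    have : x ^ (1 - 2 * H) = x ^ 2 * x ^ (-1 - 2 * H) := by
      rw [← Real.rpow_two, ← Real.rpow_add hx]; ring_nf
    have : lam ^ 2 + x ^ 2 ≠ 0 := by positivity
    simp only [*]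
    field_simp
    ring
  rw [e, integral_sub hci (by exact hwi.sub hcw), integral_sub hwi hcw, hc, hw]
  ring

/-! ### Picard series of the Volterra equation -/

theorem factorial_le_ascPochhammer_eval {x : ℝ} (hx : 1 ≤ x) (n : ℕ) :
    (n ! : ℝ) ≤ (ascPochhammer ℝ n).eval x := by
  induction n with
  | zero => simp
  | succ n ih =>
    rw [ascPochhammer_succ_eval, Nat.factorial_succ, Nat.cast_mul, mul_comm]
    refine mul_le_mul ih ?_ (by positivity) ((Nat.cast_nonneg _).trans ih)
    push_cast
    linarith

/-- The `n`-th iterate of the Volterra operator `u ↦ lam² ∫₀^s (s - t) u t dt` on `t ↦ t ^ q`,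
in closed form: `lam ^ (2n) s ^ (q + 2n) / (q + 1)_{2n}`. -/
noncomputable def volterraTerm (lam q : ℝ) (n : ℕ) (s : ℝ) : ℝ :=
  lam ^ (2 * n) * s ^ (q + (2 * n : ℕ)) / (ascPochhammer ℝ (2 * n)).eval (q + 1)

theorem integral_sub_mul_rpow {q s : ℝ} (hq : 0 ≤ q) (hs : 0 ≤ s) :
    ∫ t in (0)..s, (s - t) * t ^ q = s ^ (q + 2) / ((q + 1) * (q + 2)) := by
  have e : ∫ t in (0)..s, (s - t) * t ^ q = ∫ t in (0)..s, (s * t ^ q - t ^ (q + 1)) := by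
    refine intervalIntegral.integral_congr fun t ht => ?_
    rw [uIcc_of_le hs] at ht
    simp only [Real.rpow_add_of_nonneg ht.1 hq zero_le_one, Real.rpow_one]
    ring
  rw [e, intervalIntegral.integral_sub, intervalIntegral.integral_const_mul,
    integral_rpow (Or.inl (by linarith)), integral_rpow (Or.inl (by linarith)),
    Real.zero_rpow (by linarith), Real.zero_rpow (by linarith),
    show q + 2 = q + 1 + 1 by ring, Real.rpow_add_one' hs (y := q + 1) (by linarith)]
  · field_simp
    ring
  · exact (intervalIntegral.intervalIntegrable_rpow (Or.inl hq)).const_mul s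
  · exact intervalIntegral.intervalIntegrable_rpow (Or.inl (by linarith))

theorem continuous_volterraTerm (lam : ℝ) {q : ℝ} (hq : 0 ≤ q) (n : ℕ) :
    Continuous (volterraTerm lam q n) :=
  ((Real.continuous_rpow_const (by positivity)).const_mul _).div_const _

/-- The Volterra operator `u ↦ lam² ∫₀^s (s - t) u t dt` shifts `volterraTerm lam q`. -/
theorem integral_sub_mul_volterraTerm (lam : ℝ) {q s : ℝ} (hq : 0 ≤ q) (hs : 0 ≤ s) (n : ℕ) :
    lam ^ 2 * ∫ t in (0)..s, (s - t) * volterraTerm lam q n t = volterraTerm lam q (n + 1) s := by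
  have hP : 0 < (ascPochhammer ℝ (2 * n)).eval (q + 1) := ascPochhammer_pos _ _ (by linarith)
  have e : ∀ t, (s - t) * volterraTerm lam q n t =
      lam ^ (2 * n) / (ascPochhammer ℝ (2 * n)).eval (q + 1) *
        ((s - t) * t ^ (q + (2 * n : ℕ))) := fun t => by
    unfold volterraTerm; ring
  simp only [e]
  rw [intervalIntegral.integral_const_mul, integral_sub_mul_rpow (by positivity) hs, volterraTerm,
    mul_add 2 n 1, ascPochhammer_succ_eval, ascPochhammer_succ_eval]
  push_cast
  rw [← add_assoc q]
  have : q + 1 + 2 * (n : ℝ) ≠ 0 := by positivity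
  have : q + 1 + (2 * (n : ℝ) + 1) ≠ 0 := by positivity
  have : q + 2 * (n : ℝ) + 1 ≠ 0 := by positivity
  have : q + 2 * (n : ℝ) + 2 ≠ 0 := by positivity
  field_simp
  ring

theorem summable_volterraTerm (lam : ℝ) {q s : ℝ} (hq : 0 ≤ q) (hs : 0 ≤ s) :
    Summable fun n => volterraTerm lam q n s := by
  refine Summable.of_norm_bounded ((Real.hasSum_cosh (lam * s)).summable.mul_left (s ^ q))
    fun n => ?_
  have hle := factorial_le_ascPochhammer_eval (x := q + 1) (by linarith) (2 * n)
  have hf : (0:ℝ) < (2 * n)! := by positivity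
  have hp : 0 ≤ lam ^ (2 * n) := (even_two_mul n).pow_nonneg _
  rw [Real.norm_of_nonneg (by unfold volterraTerm; have := hf.trans_le hle; positivity),
    volterraTerm, Real.rpow_add_of_nonneg hs hq (by positivity), Real.rpow_natCast]
  rw [show s ^ q * ((lam * s) ^ (2 * n) / (2 * n)!) =
    lam ^ (2 * n) * (s ^ q * s ^ (2 * n)) / (2 * n)! by ring]
  gcongr

theorem volterraTerm_zero (lam q s : ℝ) : volterraTerm lam q 0 s = s ^ q := by
  simp [volterraTerm]

theorem volterraTerm_zero_right (lam s : ℝ) (n : ℕ) :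
    volterraTerm lam 0 n s = (lam * s) ^ (2 * n) / (2 * n)! := by
  rw [volterraTerm, zero_add, zero_add, Real.rpow_natCast, ascPochhammer_eval_one, mul_pow]

/-- The remainder after `N` Picard steps: applying the Volterra operator to the `N`-th remainder gives
the next one, and applied to `volterraTerm lam 0 N` it gives the next bound. -/
theorem abs_sub_sum_volterraTerm_le {u : ℝ → ℝ} (hu : Continuous u) {A B lam p M : ℝ}
    (hM : ∀ s, |u s| ≤ M) (hp : 0 ≤ p)
    (h : ∀ s, 0 ≤ s → u s = A - B * s ^ p + lam ^ 2 * ∫ t in (0)..s, (s - t) * u t) (N : ℕ) :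
    ∀ s, 0 ≤ s → |u s - ∑ n ∈ Finset.range N,
      (A * volterraTerm lam 0 n s - B * volterraTerm lam p n s)| ≤ M * volterraTerm lam 0 N s := by
  induction N with
  | zero => simpa [volterraTerm] using fun s _ => hM s
  | succ N ih =>
    intro s hs
    set c : ℕ → ℝ → ℝ := fun n s => A * volterraTerm lam 0 n s - B * volterraTerm lam p n s
    have hc : ∀ n, Continuous (c n) := fun n =>
      ((continuous_volterraTerm lam le_rfl n).const_mul A).sub
        ((continuous_volterraTerm lam hp n).const_mul B)
    have hcI : ∀ n, lam ^ 2 * ∫ t in (0)..s, (s - t) * c n t = c (n + 1) s := fun n => by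
      have h0 := continuous_volterraTerm lam le_rfl n
      have h1 := continuous_volterraTerm lam hp n
      have e : ∀ t, (s - t) * c n t = A * ((s - t) * volterraTerm lam 0 n t) -
        B * ((s - t) * volterraTerm lam p n t) := fun t => by simp only [c]; ring
      simp only [e]
      rw [intervalIntegral.integral_sub (Continuous.intervalIntegrable (by fun_prop) _ _)
        (Continuous.intervalIntegrable (by fun_prop) _ _), intervalIntegral.integral_const_mul,
        intervalIntegral.integral_const_mul]
      simp only [c, ← integral_sub_mul_volterraTerm lam le_rfl hs,
        ← integral_sub_mul_volterraTerm lam hp hs]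
      ring
    have key : u s - ∑ n ∈ Finset.range (N + 1), c n s =
        lam ^ 2 * ∫ t in (0)..s, (s - t) * (u t - ∑ n ∈ Finset.range N, c n t) := by
      simp only [mul_sub (s - _), Finset.mul_sum]
      have hcc : ∀ n, Continuous fun t => (s - t) * c n t := fun n =>
        (continuous_const.sub continuous_id).mul (hc n)
      have hcu : Continuous fun t => (s - t) * u t := (continuous_const.sub continuous_id).mul hu
      rw [intervalIntegral.integral_sub (hcu.intervalIntegrable _ _)
        (Continuous.intervalIntegrable (continuous_finsetSum _ fun n _ => hcc n) _ _),
        intervalIntegral.integral_finsetSum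
          fun n _ => (hcc n).intervalIntegrable _ _,
        mul_sub, Finset.mul_sum, Finset.sum_range_succ',
        Finset.sum_congr rfl fun n _ => hcI n, h s hs]
      simp only [c, volterraTerm_zero, Real.rpow_zero]
      ring
    rw [key, abs_mul, abs_of_nonneg (sq_nonneg lam),
      ← integral_sub_mul_volterraTerm lam le_rfl hs, mul_left_comm,
      ← intervalIntegral.integral_const_mul]
    refine mul_le_mul_of_nonneg_left ?_ (sq_nonneg _)
    have hv := continuous_volterraTerm lam le_rfl N
    have hvM : Continuous fun t => M * ((s - t) * volterraTerm lam 0 N t) := by fun_prop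
    rw [← Real.norm_eq_abs]
    refine intervalIntegral.norm_integral_le_of_norm_le hs (ae_of_all _ fun t ht => ?_)
      (hvM.intervalIntegrable _ _)
    rw [norm_mul, Real.norm_of_nonneg (sub_nonneg.2 ht.2), mul_left_comm]
    exact mul_le_mul_of_nonneg_left (ih t ht.1.le) (sub_nonneg.2 ht.2)

/-- A bounded continuous solution of the Volterra equation with free term `A - B s ^ p` is the sum
of its Picard series. -/
theorem hasSum_volterraTerm_of_integral_eq {u : ℝ → ℝ} (hu : Continuous u) {A B lam p M : ℝ}
    (hM : ∀ s, |u s| ≤ M) (hp : 0 ≤ p)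
    (h : ∀ s, 0 ≤ s → u s = A - B * s ^ p + lam ^ 2 * ∫ t in (0)..s, (s - t) * u t)
    {s : ℝ} (hs : 0 ≤ s) :
    HasSum (fun n => A * volterraTerm lam 0 n s - B * volterraTerm lam p n s) (u s) := by
  have hsum : Summable fun n => A * volterraTerm lam 0 n s - B * volterraTerm lam p n s :=
    ((summable_volterraTerm lam le_rfl hs).mul_left A).sub
      ((summable_volterraTerm lam hp hs).mul_left B)
  rw [hsum.hasSum_iff_tendsto_nat]
  have hz : Tendsto (fun N => M * volterraTerm lam 0 N s) atTop (𝓝 0) := by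
    simpa using (summable_volterraTerm lam le_rfl hs).tendsto_atTop_zero.const_mul M
  refine tendsto_iff_norm_sub_tendsto_zero.2
    (squeeze_zero (fun _ => norm_nonneg _) (fun N => ?_) hz)
  rw [norm_sub_rev]
  exact abs_sub_sum_volterraTerm_le hu hM hp h N s hs

/-! ### The hypergeometric series -/

/-- The duplication formula `(2x + 1)_{2n} = 4ⁿ (x + 1/2)_n (x + 1)_n` for rising factorials. -/
theorem ascPochhammer_eval_two_mul_add_one (x : ℂ) (n : ℕ) :
    (ascPochhammer ℂ (2 * n)).eval (2 * x + 1) =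
      4 ^ n * ((ascPochhammer ℂ n).eval (x + 1 / 2) * (ascPochhammer ℂ n).eval (x + 1)) := by
  induction n with
  | zero => simp
  | succ n ih =>
    rw [mul_add 2 n 1, ascPochhammer_succ_eval, ascPochhammer_succ_eval, ih,
      ascPochhammer_succ_eval, ascPochhammer_succ_eval]
    push_cast
    ring

/-- With numerator parameter `1` the factor `(1)_n / n!` is `1`, and the two denominator factors
combine by the duplication formula into `(2H + 1)_{2n}`. -/
theorem hyp1F2Term_one_eq_volterraTerm {H : ℝ} (h0 : 0 < H) (lam s : ℝ) (n : ℕ) :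
    hyp1F2Term 1 ((H : ℂ) + 1 / 2) ((H : ℂ) + 1) ((lam : ℂ) ^ 2 * (s : ℂ) ^ 2 / 4) n =
      (volterraTerm (lam * s) (2 * H) n 1 : ℝ) := by
  have hP := ascPochhammer_eval_two_mul_add_one H n
  have hP0 : (ascPochhammer ℝ (2 * n)).eval (2 * H + 1) ≠ 0 :=
    (ascPochhammer_pos _ _ (by linarith)).ne'
  have hc : (((ascPochhammer ℝ (2 * n)).eval (2 * H + 1) : ℝ) : ℂ) =
      (ascPochhammer ℂ (2 * n)).eval (2 * (H : ℂ) + 1) := by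
    have := ascPochhammer_eval₂ Complex.ofRealHom (2 * n) (Complex.ofRealHom (2 * H + 1))
    rw [Polynomial.eval₂_at_apply] at this
    simpa using this.symm
  have hf : (n ! : ℂ) ≠ 0 := by exact_mod_cast n.factorial_ne_zero
  have hne :
      (ascPochhammer ℂ n).eval ((H : ℂ) + 1 / 2) * (ascPochhammer ℂ n).eval ((H : ℂ) + 1) ≠ 0 := by
    intro h
    rw [h, mul_zero, ← hc] at hP
    exact hP0 (by exact_mod_cast hP)
  rw [hyp1F2Term, volterraTerm, ascPochhammer_eval_one, Real.one_rpow, mul_one, Complex.ofReal_div,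
    hc, hP, Complex.ofReal_pow, Complex.ofReal_mul, pow_mul, div_pow, ← mul_pow]
  field_simp

theorem summable_hyp1F2Term_one {H : ℝ} (h0 : 0 < H) (lam s : ℝ) :
    Summable (hyp1F2Term 1 ((H : ℂ) + 1 / 2) ((H : ℂ) + 1) ((lam : ℂ) ^ 2 * (s : ℂ) ^ 2 / 4)) := by
  rw [funext (hyp1F2Term_one_eq_volterraTerm h0 lam s)]
  exact (Complex.hasSum_ofReal.2
    (summable_volterraTerm (lam * s) (by positivity) zero_le_one).hasSum).summable

theorem hyp1F2_one_eq_tsum_volterraTerm {H : ℝ} (h0 : 0 < H) (lam s : ℝ) :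
    hyp1F2 1 ((H : ℂ) + 1 / 2) ((H : ℂ) + 1) ((lam : ℂ) ^ 2 * (s : ℂ) ^ 2 / 4) =
      ((∑' n, volterraTerm (lam * s) (2 * H) n 1 : ℝ) : ℂ) := by
  rw [hyp1F2, Complex.ofReal_tsum]
  exact tsum_congr (hyp1F2Term_one_eq_volterraTerm h0 lam s)

/-- The case `q = 1`, where `(2)_{2n} = (2n + 1)!`. -/
theorem mul_tsum_volterraTerm_one (x : ℝ) : x * ∑' n, volterraTerm x 1 n 1 = Real.sinh x := by
  rw [← tsum_mul_left, Real.sinh_eq_tsum]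
  refine tsum_congr fun n => ?_
  have h := factorial_mul_ascPochhammer ℝ 1 (2 * n)
  rw [Nat.factorial_one, Nat.cast_one, one_mul, add_comm 1 (2 * n)] at h
  rw [volterraTerm, h, Real.one_rpow]
  ring

theorem volterraTerm_eq_rpow_mul (lam : ℝ) {q s : ℝ} (hq : 0 ≤ q) (hs : 0 ≤ s) (n : ℕ) :
    volterraTerm lam q n s = s ^ q * volterraTerm (lam * s) q n 1 := by
  rw [volterraTerm, volterraTerm, Real.rpow_add_of_nonneg hs hq (by positivity), Real.rpow_natCast,
    Real.one_rpow]
  ring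

theorem integrable_comp_abs_of_integrableOn_Ioi {f : ℝ → ℝ} (hf : IntegrableOn f (Ioi 0)) :
    Integrable fun x => f |x| := by
  have h : IntegrableOn (fun x => f |x|) (Ioi 0) :=
    hf.congr_fun (fun x hx => by rw [abs_of_pos hx]) measurableSet_Ioi
  have h' : IntegrableOn (fun x => f |x|) (Iic 0) := by
    have m : MeasurableEmbedding fun x : ℝ => -x := (Homeomorph.neg ℝ).measurableEmbedding
    rw [← Measure.map_neg_eq_self (volume : Measure ℝ), m.integrableOn_map_iff]
    simpa [Function.comp_def] using Iff.mpr integrableOn_Ici_iff_integrableOn_Ioi h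
  rw [← integrableOn_univ, ← Iic_union_Ioi (a := (0 : ℝ))]
  exact h'.union h

theorem integrable_fouIntegrand {lam H : ℝ} (hl : 0 < lam) (h0 : 0 < H) (h1 : H < 1) (s : ℝ) :
    Integrable (fouIntegrand H lam s) := by
  have hw := integrable_comp_abs_of_integrableOn_Ioi (integral_Ioi_rpow_div_sq_add_sq hl h0 h1).1
  simp only [sq_abs] at hw
  refine hw.ofReal.bdd_mul (c := 1) (by fun_prop) (ae_of_all _ fun x => ?_)
  rw [show Complex.I * (s : ℂ) * (x : ℂ) = ((s * x : ℝ) : ℂ) * Complex.I by push_cast; ring,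
    Complex.norm_exp_ofReal_mul_I]

theorem fouHat_eq_integral_cos {lam H : ℝ} (hl : 0 < lam) (h0 : 0 < H) (h1 : H < 1) (s : ℝ) :
    fouHat H lam s = ((2 * ∫ x in Ioi 0, Real.cos (s * x) *
      (x ^ (1 - 2 * H) / (lam ^ 2 + x ^ 2)) : ℝ) : ℂ) := by
  have hi := integrable_fouIntegrand hl h0 h1 s
  -- Adding the integrand and its reflection cancels the odd imaginary part.
  have hsum : fouHat H lam s + fouHat H lam s = ∫ x : ℝ, (2 : ℂ) *
      ((Real.cos (s * |x|) * (|x| ^ (1 - 2 * H) / (lam ^ 2 + |x| ^ 2)) : ℝ) : ℂ) := by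
    nth_rewrite 2 [fouHat]
    rw [← integral_neg_eq_self (fouIntegrand H lam s), fouHat, ← integral_add hi hi.comp_neg]
    refine integral_congr_ae (ae_of_all _ fun x => ?_)
    have hcos : Real.cos (s * |x|) = Real.cos (s * x) := by
      rcases abs_choice x with h | h <;> simp [h]
    simp only [fouIntegrand, abs_neg, neg_sq, sq_abs, hcos]
    rw [← add_mul, Complex.ofReal_mul, ← mul_assoc, Complex.ofReal_cos, Complex.two_cos]
    push_cast
    ring_nf
  rw [integral_const_mul, ← two_mul, integral_complex_ofReal,
    integral_comp_abs (f := fun x => Real.cos (s * x) * (x ^ (1 - 2 * H) / (lam ^ 2 + x ^ 2)))]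
    at hsum
  exact mul_left_cancel₀ two_ne_zero hsum

theorem fouHat_eq_cosh_sub_hyp1F2 {lam H s : ℝ} (hl : 0 < lam) (h0 : 0 < H) (h1 : H < 1)
    (hs : 0 ≤ s) :
    fouHat H lam s = ((Real.pi / Real.sin (Real.pi * H) : ℝ) : ℂ) *
      (((lam ^ (-2 * H) * Real.cosh (lam * s) : ℝ) : ℂ) -
        ((s ^ (2 * H) / Real.Gamma (2 * H + 1) : ℝ) : ℂ) *
          hyp1F2 1 ((H : ℂ) + 1 / 2) ((H : ℂ) + 1) ((lam : ℂ) ^ 2 * (s : ℂ) ^ 2 / 4)) := by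
  have hw := (integral_Ioi_rpow_div_sq_add_sq hl h0 h1).1
  have h2 : 0 ≤ 2 * H := by positivity
  have hu := hasSum_volterraTerm_of_integral_eq (continuous_integral_cos_mul hw)
    (abs_integral_cos_mul_le hw) h2 (fun t ht => integral_cos_mul_volterra hl h0 h1 ht) hs
  have hv := (summable_volterraTerm (lam * s) h2 zero_le_one).hasSum.mul_left (s ^ (2 * H))
  simp only [← volterraTerm_eq_rpow_mul lam h2 hs] at hv
  have hc := Real.hasSum_cosh (lam * s)
  simp only [← volterraTerm_zero_right] at hc
  rw [fouHat_eq_integral_cos hl h0 h1, hu.unique ((hc.mul_left _).sub (hv.mul_left _)),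
    hyp1F2_one_eq_tsum_volterraTerm h0]
  push_cast
  ring

theorem fouHat_one_half {lam s : ℝ} (hl : 0 < lam) (hs : 0 ≤ s) :
    fouHat (1 / 2) lam s = ((Real.pi / lam * Real.exp (-lam * s) : ℝ) : ℂ) := by
  have h0 : (0 : ℝ) < 1 / 2 := by norm_num
  rw [fouHat_eq_cosh_sub_hyp1F2 hl h0 (by norm_num) hs, hyp1F2_one_eq_tsum_volterraTerm h0]
  simp only [← Complex.ofReal_mul, ← Complex.ofReal_sub]
  congr 1
  have hsinh := mul_tsum_volterraTerm_one (lam * s)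
  have hG : Real.Gamma (1 + 1) = 1 := by norm_num
  rw [mul_one_div, Real.sin_pi_div_two, show (-2 : ℝ) * (1 / 2) = -1 by norm_num,
    show (2 : ℝ) * (1 / 2) = 1 by norm_num, hG, Real.rpow_one, Real.rpow_neg_one, neg_mul,
    ← Real.cosh_sub_sinh, ← hsinh]
  field_simp

theorem mainTheorem9 :
    (∀ lam H s : ℝ, 0 < lam → 0 < H → H < 1 → 0 ≤ s →
      Integrable (fouIntegrand H lam s) volume ∧
      Summable (hyp1F2Term 1 ((H : ℂ) + 1 / 2) ((H : ℂ) + 1) ((lam : ℂ) ^ 2 * (s : ℂ) ^ 2 / 4)) ∧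
      fouHat H lam s =
        ((Real.pi / Real.sin (Real.pi * H) : ℝ) : ℂ) *
          (((lam ^ (-2 * H) * Real.cosh (lam * s) : ℝ) : ℂ) -
            ((s ^ (2 * H) / Real.Gamma (2 * H + 1) : ℝ) : ℂ) *
              hyp1F2 1 ((H : ℂ) + 1 / 2) ((H : ℂ) + 1) ((lam : ℂ) ^ 2 * (s : ℂ) ^ 2 / 4))) ∧
    (∀ lam s : ℝ, 0 < lam → 0 ≤ s →
      fouHat (1 / 2) lam s = ((Real.pi / lam * Real.exp (-lam * s) : ℝ) : ℂ)) :=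
  ⟨fun lam _ s hl h0 h1 hs => ⟨integrable_fouIntegrand hl h0 h1 s,
    summable_hyp1F2Term_one h0 lam s, fouHat_eq_cosh_sub_hyp1F2 hl h0 h1 hs⟩,
    fun _ _ hl hs => fouHat_one_half hl hs⟩
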